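/- Let $\mathcal K$ be a locally presentable category and let $(\mathcal L,\mathcal R)$ be an accessible weak factorization system in $\mathcal K$; that is, $(\mathcal L,\mathcal R)$ is a weak factorization system which admits a functorial factorization $f = R(f)\circ L(f)$, with $L(f)\in\mathcal L$ and $R(f)\in\mathcal R$, such that the factorization functor $\mathcal K^{\to}\to\mathcal K^{\to\to}$ from the category of morphisms of $\mathcal K$ to the category of composable pairs of morphisms of $\mathcal K$, sending $f$ to $(L(f),R(f))$, is accessible (it preserves $\lambda$-directed colimits for some regular cardinal $\lambda$). Let $\mathcal L\text{-}\mathrm{Inj}$ be the full subcategory of $\mathcal K$ on the $\mathcal L$-injective objects, i.e. the objects $K$ such that for every $i\colon A\to B$ in $\mathcal L$ each morphism $A\to K$ factors through $i$. Then there are a locally presentable category $\mathcal M$ and a functor $F\colon\mathcal M\to\mathcal K$ which preserves all small limits and is accessible, such that $\mathcal L\text{-}\mathrm{Inj}$ is the full image of $F$, i.e. the full subcategory of $\mathcal K$ consisting of the objects $FM$ with $M\in\mathcal M$. -/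

import Mathlib

open CategoryTheory Limits MorphismProperty

universe w v u v' u'

namespace AccessibleWFS

section

variable {C : Type u} [Category.{v} C]

/-- The functor from the category of morphisms of `C` to the category of composable pairs of
morphisms of `C` attached to a functorial factorization: it sends `f : X ⟶ Y` to
`X ⟶ Z f ⟶ Y`. -/
def factorizationFunctor {L R : MorphismProperty C} (data : FunctorialFactorizationData L R) :
    Arrow C ⥤ ComposableArrows C 2 where
  obj f := ComposableArrows.mk₂ (data.i.app f) (data.p.app f)
  map φ := ComposableArrows.homMk₂ φ.left (data.Z.map φ) φ.right
    (data.i.naturality φ).symm (data.p.naturality φ).symm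
  map_id f := ComposableArrows.hom_ext₂ rfl (data.Z.map_id f) rfl
  map_comp φ ψ := ComposableArrows.hom_ext₂ rfl (data.Z.map_comp φ ψ) rfl

/-- `(L, R)` is an accessible weak factorization system: it is a weak factorization system which
has a functorial factorization (first factor in `L`, second factor in `R`) whose
factorization functor from morphisms to composable pairs is accessible, that is, preserves
`κ`-filtered colimits for some (`w`-small) regular cardinal `κ`. -/
structure IsAccessibleWFS (L R : MorphismProperty C) : Prop where
  isWeakFactorizationSystem : IsWeakFactorizationSystem L R
  exists_accessible : ∃ data : FunctorialFactorizationData L R,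
    Functor.IsAccessible.{w} (factorizationFunctor data)

/-- The full subcategory `L`-Inj of `L`-injective objects: `K` is `L`-injective if every morphism
`a : A ⟶ K` extends along every morphism `i : A ⟶ B` of `L`. -/
def injectives (L : MorphismProperty C) : ObjectProperty C := fun K ↦
  ∀ ⦃A B : C⦄ (i : A ⟶ B), L i → ∀ a : A ⟶ K, ∃ b : B ⟶ K, i ≫ b = a

/-- The full image of a functor `F : M ⥤ C`: the full subcategory of `C` on the objects `F m`. -/
def fullImage {M : Type u'} [Category.{v'} M] (F : M ⥤ C) : ObjectProperty C := fun K ↦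
  ∃ m : M, F.obj m = K

end

end AccessibleWFS

/-!
# Injective objects of an accessible weak factorization system

Factoring the morphism `K ⟶ 1` functorially as `K ⟶ W K ⟶ 1` gives an accessible endofunctor `W`
with a unit `η : 𝟭 ⟶ W`. As `η K` is in `L` and `W K ⟶ 1` is in `R`, the object `K` is
`L`-injective if and only if `η K` has a retraction `r : W K ⟶ K`
(`injectives_iff_exists_retraction`). The algebras `(K, r)` of the pointed endofunctor `(W, η)` thus
have the injective objects as underlying objects, and they should form a locally presentable
category.

This is seen without constructing free algebras. Consider the comma category `Comma W (𝟭 C)` of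
morphisms `f : W A ⟶ B`. It is locally presentable: colimits are computed by pushouts
(`hasColimit_comma_id`), both projections to `C` are accessible and have left adjoints, and
the images under these left adjoints of presentable generators form a strong generator
(`isCardinalLocallyPresentable_comma_id`). Algebras correspond to the objects `f : W A ⟶ B` such
that the composite `commaUnit : A ⟶ W A ⟶ B` is an isomorphism. By adjunction, this is the
condition of being orthogonal to a small set of morphisms between presentable objects
(`isLocal_commaMates_iff`). Hence these objects form a locally presentable full subcategory, whose
inclusion is accessible and a right adjoint; composing it with the projection `Comma.fst`, which is
also accessible and a right adjoint, gives the required functor (`exists_fullImage_of_pointed`).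
-/

namespace AccessibleWFS

/-! ### Terminal objects of locally presentable categories -/

section Terminal

/-- The colimit of all `κ`-presentable objects is terminal: every object is a colimit of
`κ`-presentable objects, which yields a morphism to it, and the `κ`-presentable objects form a
filtered category, so that any morphism to the colimit from a `κ`-presentable object is a
coprojection. -/
lemma hasTerminal_of_isCardinalLocallyPresentable (C : Type u) [Category.{v} C]
    (κ : Cardinal.{w}) [Fact κ.IsRegular] [IsCardinalLocallyPresentable C κ] : HasTerminal C := by
  let P := isCardinalPresentable C κ
  have : HasColimitsOfShape P.FullSubcategory C :=
    hasColimitsOfShape_of_equivalence (equivSmallModel.{w} P.FullSubcategory).symm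
  -- `κ`-presentable objects are closed under `κ`-small colimits
  have : IsCardinalFiltered P.FullSubcategory κ := ⟨fun {J} _ K hJ ↦ by
    have : P.IsClosedUnderColimitsOfShape J :=
      isClosedUnderColimitsOfShape_isCardinalPresentable C hJ
    exact ⟨colimit.cocone K⟩⟩
  have := isFiltered_of_isCardinalFiltered P.FullSubcategory κ
  have h₁ (G : P.FullSubcategory) (g : G.obj ⟶ colimit P.ι) : g = colimit.ι P.ι G := by
    obtain ⟨G', f, rfl⟩ := IsCardinalPresentable.exists_hom_of_isColimit κ (colimit.isColimit P.ι) g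
    exact colimit.w P.ι (ObjectProperty.homMk f : G ⟶ G')
  have h₂ (X : C) : Nonempty (Unique (X ⟶ colimit P.ι)) := by
    refine ⟨⟨⟨(P.ι.denseAt X).desc ⟨_, { app j := colimit.ι P.ι j.left, naturality := ?_ }⟩⟩, ?_⟩⟩
    · intro j j' f
      exact (colimit.w P.ι f.left).trans (Category.comp_id _).symm
    · intro f
      refine (P.ι.denseAt X).hom_ext fun j ↦ ?_
      exact (h₁ j.left _).trans (h₁ j.left _).symm
  have (X : C) := (h₂ X).some
  exact hasTerminal_of_unique (colimit P.ι)

end Terminal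

/-! ### Isomorphisms detected by a strong generator -/

section StrongGenerator

variable {C : Type u} [Category.{v} C]

lemma isIso_of_isStrongGenerator {P : ObjectProperty C} (hP : P.IsStrongGenerator) {X Y : C}
    (f : X ⟶ Y) (hf : ∀ G, P G → Function.Bijective (fun g : G ⟶ X ↦ g ≫ f)) : IsIso f := by
  have : Mono f := by
    rw [hP.isSeparating.mono_iff]
    exact fun G hG g₁ g₂ h ↦ (hf G hG).1 h
  exact hP.isIso_of_mono f fun G hG ↦ (hf G hG).2

end StrongGenerator

/-! ### The comma category of an accessible functor and an identity functor -/

section Comma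

variable {A : Type u} [Category.{v} A] {B : Type u'} [Category.{v'} B] (W : A ⥤ B)

/-- `W` is not assumed to preserve the colimit: the right component of the colimit is the pushout of
`colim B_j` and `W (colim A_j)` over `colim W A_j`. -/
lemma hasColimit_comma_id {J : Type*} [Category* J] (F : J ⥤ Comma W (𝟭 B))
    [HasColimit (F ⋙ Comma.fst _ _)] [HasColimit (F ⋙ Comma.snd _ _)]
    [HasColimit ((F ⋙ Comma.fst _ _) ⋙ W)] [HasPushouts B] : HasColimit F := by
  let a := colimit.cocone (F ⋙ Comma.fst _ _)
  let b := colimit.cocone (F ⋙ Comma.snd _ _)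
  let s : colimit ((F ⋙ Comma.fst _ _) ⋙ W) ⟶ W.obj a.pt := colimit.desc _ (W.mapCocone a)
  let t : colimit ((F ⋙ Comma.fst _ _) ⋙ W) ⟶ b.pt :=
    colimit.desc _ (Comma.colimitAuxiliaryCocone F b)
  have hs (j : J) : colimit.ι ((F ⋙ Comma.fst _ _) ⋙ W) j ≫ s = W.map (a.ι.app j) :=
    colimit.ι_desc _ _
  have ht (j : J) : colimit.ι ((F ⋙ Comma.fst _ _) ⋙ W) j ≫ t = (F.obj j).hom ≫ b.ι.app j :=
    colimit.ι_desc _ _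
  let c : Cocone F :=
    { pt := { left := a.pt, right := pushout s t, hom := pushout.inl s t }
      ι :=
        { app j :=
            { left := a.ι.app j
              right := b.ι.app j ≫ pushout.inr s t
              w := by
                change W.map _ ≫ pushout.inl s t = (F.obj j).hom ≫ _ ≫ _
                rw [← hs, Category.assoc, pushout.condition, reassoc_of% ht] }
          naturality j j' f := by
            ext
            · exact a.ι.naturality f
            · change (F.map f).right ≫ b.ι.app j' ≫ pushout.inr s t =
                (b.ι.app j ≫ pushout.inr s t) ≫ 𝟙 _
              rw [Category.comp_id, ← Category.assoc]
              congr 1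
              exact b.w f } }
  refine ⟨⟨c, ?_⟩⟩
  let l (d : Cocone F) : a.pt ⟶ d.pt.left := colimit.desc _ ((Comma.fst _ _).mapCocone d)
  let r (d : Cocone F) : b.pt ⟶ d.pt.right := colimit.desc _ ((Comma.snd _ _).mapCocone d)
  have hl (d : Cocone F) (j : J) : a.ι.app j ≫ l d = (d.ι.app j).left := colimit.ι_desc _ _
  have hr (d : Cocone F) (j : J) : b.ι.app j ≫ r d = (d.ι.app j).right := colimit.ι_desc _ _
  have hlr (d : Cocone F) : s ≫ W.map (l d) ≫ d.pt.hom = t ≫ r d := by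
    refine colimit.hom_ext fun j ↦ ?_
    rw [reassoc_of% hs, reassoc_of% ht, hr, ← W.map_comp_assoc, hl]
    exact (d.ι.app j).w
  exact
    { desc d :=
        { left := l d
          right := pushout.desc (W.map (l d) ≫ d.pt.hom) (r d) (hlr d)
          w := (pushout.inl_desc _ _ _).symm }
      fac d j := by
        ext
        · exact hl d j
        · change (b.ι.app j ≫ pushout.inr s t) ≫ pushout.desc _ _ _ = _
          rw [Category.assoc, pushout.inr_desc, hr]
      uniq d m hm := by
        have h₁ : m.left = l d := colimit.hom_ext fun j ↦
          (congr_arg CommaMorphism.left (hm j)).trans (hl d j).symm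
        have h₂ : pushout.inl s t ≫ m.right = W.map (l d) ≫ d.pt.hom := by
          rw [← h₁]
          exact m.w.symm
        have h₃ : pushout.inr s t ≫ m.right = r d := colimit.hom_ext fun j ↦
          ((Category.assoc _ _ _).symm.trans (congr_arg CommaMorphism.right (hm j))).trans
            (hr d j).symm
        exact Comma.hom_ext _ _ h₁ (pushout.hom_ext (h₂.trans (pushout.inl_desc _ _ _).symm)
            (h₃.trans (pushout.inr_desc _ _ _).symm)) }

/-- The left adjoint of `Comma.fst W (𝟭 B)`, sending `a` to `𝟙 : W a ⟶ W a`. -/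
@[simps]
def commaFree : A ⥤ Comma W (𝟭 B) where
  obj a := { left := a, right := W.obj a, hom := 𝟙 _ }
  map f := { left := f, right := W.map f }

/-- The adjunction between `commaFree W` and `Comma.fst W (𝟭 B)`. -/
def commaFreeAdj : commaFree W ⊣ Comma.fst W (𝟭 B) :=
  Adjunction.mkOfHomEquiv
    { homEquiv a X :=
        { toFun f := f.left
          invFun f :=
            { left := f, right := W.map f ≫ X.hom, w := (Category.id_comp _).symm }
          left_inv f := by
            ext
            · rfl
            · exact f.w.trans (Category.id_comp _)
          right_inv f := rfl }
      homEquiv_naturality_left_symm f g :=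
        Comma.hom_ext _ _ rfl
          ((congr_arg (· ≫ _) (W.map_comp f g)).trans (Category.assoc _ _ _)) }

@[simp]
lemma commaFreeAdj_homEquiv_apply {a : A} {X : Comma W (𝟭 B)} (f : (commaFree W).obj a ⟶ X) :
    (commaFreeAdj W).homEquiv a X f = f.left := by
  rw [commaFreeAdj, Adjunction.mkOfHomEquiv_homEquiv]
  rfl

section

variable [HasInitial A] [HasBinaryCoproducts B]

/-- The left adjoint of `Comma.snd W (𝟭 B)`, sending `b` to the inclusion `W ∅ ⟶ b ⨿ W ∅`. -/
@[simps]
noncomputable def commaCofree : B ⥤ Comma W (𝟭 B) where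
  obj b := { left := ⊥_ A, right := b ⨿ W.obj (⊥_ A), hom := coprod.inr }
  map f := { left := 𝟙 _, right := coprod.map f (𝟙 _) }

/-- The adjunction between `commaCofree W` and `Comma.snd W (𝟭 B)`. -/
noncomputable def commaCofreeAdj : commaCofree W ⊣ Comma.snd W (𝟭 B) :=
  Adjunction.mkOfHomEquiv
    { homEquiv b X :=
        { toFun f := coprod.inl ≫ f.right
          invFun f :=
            { left := initial.to _
              right := coprod.desc f (W.map (initial.to _) ≫ X.hom)
              w := (coprod.inr_desc _ _).symm }
          left_inv f := by
            ext
            · exact initial.hom_ext _ _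
            · refine coprod.hom_ext (coprod.inl_desc _ _) ?_
              have h : W.map f.left ≫ X.hom = coprod.inr ≫ f.right := f.w
              exact (coprod.inr_desc _ _).trans
                ((congr_arg (fun g ↦ W.map g ≫ X.hom) (initial.hom_ext _ _)).trans h)
          right_inv f := coprod.inl_desc _ _ }
      homEquiv_naturality_left_symm f g := by
        ext
        · exact initial.hom_ext _ _
        · refine coprod.hom_ext ?_ ?_
          · exact (coprod.inl_desc _ _).trans ((coprod.inl_map_assoc _ _ _).trans
              (congr_arg (f ≫ ·) (coprod.inl_desc _ _))).symm
          · exact (coprod.inr_desc _ _).trans ((coprod.inr_map_assoc _ _ _).trans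
              ((Category.id_comp _).trans (coprod.inr_desc _ _))).symm
      homEquiv_naturality_right f g := (Category.assoc _ _ _).symm }

end

variable (κ : Cardinal.{w}) [Fact κ.IsRegular]

lemma isCardinalAccessible_comma_fst [HasColimitsOfSize.{w, w} A] [HasColimitsOfSize.{w, w} B]
    [W.IsCardinalAccessible κ] : (Comma.fst W (𝟭 B)).IsCardinalAccessible κ where
  preservesColimitOfShape J _ _ := by
    have := W.preservesColimitsOfShape_of_isCardinalAccessible κ J
    infer_instance

lemma isCardinalAccessible_comma_snd [HasColimitsOfSize.{w, w} A] [HasColimitsOfSize.{w, w} B]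
    [W.IsCardinalAccessible κ] : (Comma.snd W (𝟭 B)).IsCardinalAccessible κ where
  preservesColimitOfShape J _ _ := by
    have := W.preservesColimitsOfShape_of_isCardinalAccessible κ J
    infer_instance

/-- The images of generators of `A` and `B` under the left adjoints of the two projections form a
strong generator. -/
lemma isCardinalLocallyPresentable_comma_id [IsCardinalLocallyPresentable A κ]
    [IsCardinalLocallyPresentable B κ] [W.IsCardinalAccessible κ] :
    IsCardinalLocallyPresentable (Comma W (𝟭 B)) κ := by
  have : HasColimitsOfSize.{0, 0} A := hasColimitsOfSizeShrink.{0, 0, w, w} A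
  have : HasColimitsOfSize.{0, 0} B := hasColimitsOfSizeShrink.{0, 0, w, w} B
  have : LocallySmall.{w} (Comma W (𝟭 B)) :=
    ⟨fun X Y ↦ _root_.small_of_injective (β := (X.left ⟶ Y.left) × (X.right ⟶ Y.right))
      (f := fun f ↦ (f.left, f.right)) fun f g h ↦ by
        ext
        · exact congr_arg Prod.fst h
        · exact congr_arg Prod.snd h⟩
  have : HasColimitsOfSize.{w, w} (Comma W (𝟭 B)) :=
    ⟨fun J _ ↦ ⟨fun F ↦ hasColimit_comma_id W F⟩⟩
  have := isCardinalAccessible_comma_fst W κ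
  have := isCardinalAccessible_comma_snd W κ
  obtain ⟨P, _, hP₁, hP₂⟩ :=
    (IsCardinalLocallyPresentable.iff_exists_isStrongGenerator A κ).1 inferInstance
  obtain ⟨Q, _, hQ₁, hQ₂⟩ :=
    (IsCardinalLocallyPresentable.iff_exists_isStrongGenerator B κ).1 inferInstance
  rw [IsCardinalLocallyPresentable.iff_exists_isStrongGenerator]
  let obj : Subtype P ⊕ Subtype Q → Comma W (𝟭 B) :=
    Sum.elim (fun a ↦ (commaFree W).obj a.1) (fun b ↦ (commaCofree W).obj b.1)
  let S : ObjectProperty (Comma W (𝟭 B)) := .ofObj obj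
  have hS₁ {a : A} (ha : P a) : S ((commaFree W).obj a) :=
    ObjectProperty.ofObj_apply obj (Sum.inl ⟨a, ha⟩)
  have hS₂ {b : B} (hb : Q b) : S ((commaCofree W).obj b) :=
    ObjectProperty.ofObj_apply obj (Sum.inr ⟨b, hb⟩)
  refine ⟨S, inferInstance, ?_, ?_⟩
  · rw [ObjectProperty.isStrongGenerator_iff]
    constructor
    · intro X Y f g h
      ext
      · refine hP₁.isSeparating _ _ fun a ha x ↦ ?_
        have := h _ (hS₁ ha) (((commaFreeAdj W).homEquiv a X).symm x)
        replace this := congr_arg ((commaFreeAdj W).homEquiv a Y) this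
        simp only [(commaFreeAdj W).homEquiv_naturality_right, Equiv.apply_symm_apply] at this
        exact this
      · refine hQ₁.isSeparating _ _ fun b hb x ↦ ?_
        have := h _ (hS₂ hb) (((commaCofreeAdj W).homEquiv b X).symm x)
        replace this := congr_arg ((commaCofreeAdj W).homEquiv b Y) this
        simp only [(commaCofreeAdj W).homEquiv_naturality_right, Equiv.apply_symm_apply] at this
        exact this
    · intro X Y f _ hf
      have := (commaFreeAdj W).isRightAdjoint
      have := (commaCofreeAdj W).isRightAdjoint
      have : IsIso f.left := hP₁.isIso_of_mono ((Comma.fst W (𝟭 B)).map f) fun a ha y ↦ by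
        obtain ⟨x, hx⟩ := hf _ (hS₁ ha) (((commaFreeAdj W).homEquiv a Y).symm y)
        refine ⟨(commaFreeAdj W).homEquiv a X x, ?_⟩
        dsimp only at hx ⊢
        rw [← Adjunction.homEquiv_naturality_right, hx, Equiv.apply_symm_apply]
      have : IsIso f.right := hQ₁.isIso_of_mono ((Comma.snd W (𝟭 B)).map f) fun b hb y ↦ by
        obtain ⟨x, hx⟩ := hf _ (hS₂ hb) (((commaCofreeAdj W).homEquiv b Y).symm y)
        refine ⟨(commaCofreeAdj W).homEquiv b X x, ?_⟩
        dsimp only at hx ⊢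
        rw [← Adjunction.homEquiv_naturality_right, hx, Equiv.apply_symm_apply]
      exact (Comma.isoMk (asIso f.left) (asIso f.right) f.w).isIso_hom
  · rintro _ ⟨⟨a, ha⟩ | ⟨b, hb⟩⟩
    · have : IsCardinalPresentable a κ := hP₂ a ha
      exact (commaFreeAdj W).isCardinalPresentable_leftAdjoint_obj κ a
    · have : IsCardinalPresentable b κ := hQ₂ b hb
      exact (commaCofreeAdj W).isCardinalPresentable_leftAdjoint_obj κ b

end Comma

/-! ### Pointed endofunctors and orthogonality in the comma category -/

section PointedEndofunctor

variable {C : Type u} [Category.{v} C] {W : C ⥤ C} (η : 𝟭 C ⟶ W)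

/-- The canonical morphism `A ⟶ W A ⟶ B` attached to an object `W A ⟶ B` of the comma category
of a pointed endofunctor `(W, η)`. -/
def commaUnit (X : Comma W (𝟭 C)) : X.left ⟶ X.right := η.app X.left ≫ X.hom

/-- An object `c` carries a retraction of `η.app c` if and only if it is the source of an object
of the comma category whose `commaUnit` is an isomorphism. -/
lemma exists_retraction_iff (c : C) :
    (∃ r : W.obj c ⟶ c, η.app c ≫ r = 𝟙 c) ↔
      ∃ X : Comma W (𝟭 C), IsIso (commaUnit η X) ∧ X.left = c := by
  constructor
  · rintro ⟨r, hr⟩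
    refine ⟨{ left := c, right := c, hom := r }, ?_, rfl⟩
    have : commaUnit η { left := c, right := c, hom := r } = 𝟙 c := hr
    rw [this]
    infer_instance
  · rintro ⟨X, hX, rfl⟩
    exact ⟨X.hom ≫ inv (commaUnit η X),
      (Category.assoc _ _ _).symm.trans (IsIso.hom_inv_id (commaUnit η X))⟩

variable [HasInitial C] [HasBinaryCoproducts C]

/-- The morphism representing composition with `commaUnit`: by the two adjunctions, precomposing
morphisms to `X` with it amounts to the map `(c ⟶ X.left) → (c ⟶ X.right)` of postcomposition with
`commaUnit η X`. -/
noncomputable def commaMate (c : C) : (commaCofree W).obj c ⟶ (commaFree W).obj c :=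
  ((commaCofreeAdj W).homEquiv c ((commaFree W).obj c)).symm (η.app c)

lemma homEquiv_commaMate_comp {c : C} {X : Comma W (𝟭 C)} (g : (commaFree W).obj c ⟶ X) :
    (commaCofreeAdj W).homEquiv c X (commaMate η c ≫ g) =
      (commaFreeAdj W).homEquiv c X g ≫ commaUnit η X := by
  have h₀ : (commaCofreeAdj W).homEquiv c _ (commaMate η c) = η.app c :=
    Equiv.apply_symm_apply _ _
  rw [Adjunction.homEquiv_naturality_right, h₀, commaFreeAdj_homEquiv_apply]
  have h (f : c ⟶ X.left) (k : W.obj c ⟶ X.right) (hk : W.map f ≫ X.hom = k) :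
      η.app c ≫ k = f ≫ commaUnit η X := by
    rw [← hk]
    exact (η.naturality_assoc f X.hom).symm
  exact h g.left g.right (g.w.trans (Category.id_comp _))

lemma bijective_commaMate_comp_iff (c : C) (X : Comma W (𝟭 C)) :
    Function.Bijective (fun g : (commaFree W).obj c ⟶ X ↦ commaMate η c ≫ g) ↔
      Function.Bijective (fun f : c ⟶ X.left ↦ f ≫ commaUnit η X) := by
  have : (commaCofreeAdj W).homEquiv c X ∘ (fun g ↦ commaMate η c ≫ g) =
      (fun f : c ⟶ X.left ↦ f ≫ commaUnit η X) ∘ (commaFreeAdj W).homEquiv c X :=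
    funext fun g ↦ homEquiv_commaMate_comp η g
  rw [← Function.Bijective.of_comp_iff' ((commaCofreeAdj W).homEquiv c X).bijective, this,
    Function.Bijective.of_comp_iff _ ((commaFreeAdj W).homEquiv c X).bijective]

/-- The morphisms `commaMate η c` for `c` in `P`. -/
noncomputable def commaMates (P : ObjectProperty C) : MorphismProperty (Comma W (𝟭 C)) :=
  .ofHoms (fun c : Subtype P ↦ commaMate η c.1)

/-- The invertibility of `commaUnit` is an orthogonality condition, because isomorphisms are detected
by the morphisms from the objects of a strong generator. -/
lemma isLocal_commaMates_iff {P : ObjectProperty C} (hP : P.IsStrongGenerator)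
    (X : Comma W (𝟭 C)) : (commaMates η P).isLocal X ↔ IsIso (commaUnit η X) := by
  constructor
  · intro h
    exact isIso_of_isStrongGenerator hP _ fun c hc ↦
      (bijective_commaMate_comp_iff η c X).1 (h _ (MorphismProperty.ofHoms.mk (⟨c, hc⟩ : Subtype P)))
  · intro h Y Z f hf
    cases hf with
    | mk c =>
      exact (bijective_commaMate_comp_iff η c.1 X).2
        ⟨fun f g hfg ↦ (cancel_mono (commaUnit η X)).1 hfg,
          fun f ↦ ⟨f ≫ inv (commaUnit η X), by simp⟩⟩

end PointedEndofunctor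

/-- For an accessible pointed endofunctor of a locally presentable category, the objects whose
unit has a retraction form the full image of a continuous accessible functor from a locally
presentable category. -/
lemma exists_fullImage_of_pointed {C : Type u} [Category.{v} C] (κ : Cardinal.{w})
    [Fact κ.IsRegular] [IsCardinalLocallyPresentable C κ] {W : C ⥤ C} [W.IsCardinalAccessible κ]
    (η : 𝟭 C ⟶ W) :
    ∃ (M : Type (max u v)) (_ : Category.{v} M) (F : M ⥤ C),
      IsLocallyPresentable.{w} M ∧
      PreservesLimitsOfSize.{w, w} F ∧
      Functor.IsAccessible.{w} F ∧
      (fun c ↦ ∃ r : W.obj c ⟶ c, η.app c ≫ r = 𝟙 c : ObjectProperty C) = fullImage F := by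
  have : HasColimitsOfSize.{0, 0} C := hasColimitsOfSizeShrink.{0, 0, w, w} C
  have : IsCardinalLocallyPresentable (Comma W (𝟭 C)) κ :=
    isCardinalLocallyPresentable_comma_id W κ
  have := isCardinalAccessible_comma_fst W κ
  have := isCardinalAccessible_comma_snd W κ
  obtain ⟨P, _, hP₁, hP₂⟩ :=
    (IsCardinalLocallyPresentable.iff_exists_isStrongGenerator C κ).1 inferInstance
  let S := commaMates η P
  have : MorphismProperty.IsSmall.{w} S := by dsimp only [S, commaMates]; infer_instance
  have hS ⦃X Y : Comma W (𝟭 C)⦄ (f : X ⟶ Y) (hf : S f) :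
      IsCardinalPresentable X κ ∧ IsCardinalPresentable Y κ := by
    obtain ⟨⟨c, hc⟩⟩ := hf
    have : IsCardinalPresentable c κ := hP₂ c hc
    exact ⟨(commaCofreeAdj W).isCardinalPresentable_leftAdjoint_obj κ c,
      (commaFreeAdj W).isCardinalPresentable_leftAdjoint_obj κ c⟩
  have := (commaFreeAdj W).isRightAdjoint
  have := isRightAdjoint_ι_isLocal S κ hS
  have := isCardinalAccessible_ι_isLocal S κ hS
  refine ⟨S.isLocal.FullSubcategory, inferInstance, S.isLocal.ι ⋙ Comma.fst W (𝟭 C),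
    ⟨κ, inferInstance, isLocallyPresentable_isLocal S κ hS⟩,
    (Adjunction.ofIsRightAdjoint _).rightAdjoint_preservesLimits,
    Functor.isAccessible_of_isCardinalAccessible _ κ, ?_⟩
  ext c
  refine (exists_retraction_iff η c).trans ⟨?_, ?_⟩
  · rintro ⟨X, hX, rfl⟩
    exact ⟨⟨X, (isLocal_commaMates_iff η hP₁ X).2 hX⟩, rfl⟩
  · rintro ⟨X, rfl⟩
    exact ⟨X.obj, (isLocal_commaMates_iff η hP₁ X.obj).1 X.property, rfl⟩

/-! ### Factorizations of the morphisms to the terminal object -/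

section FactorizationToTerminal

variable {C : Type u} [Category.{v} C] [HasTerminal C]

variable (C) in
/-- The functor sending an object `c` to the morphism from `c` to the terminal object. -/
@[simps]
noncomputable def arrowToTerminal : C ⥤ Arrow C where
  obj c := Arrow.mk (terminal.from c)
  map f := Arrow.homMk f (𝟙 _) (terminal.hom_ext _ _)

lemma isCardinalAccessible_arrowToTerminal (κ : Cardinal.{w}) [Fact κ.IsRegular] :
    (arrowToTerminal C).IsCardinalAccessible κ where
  preservesColimitOfShape J _ _ :=
    have := isFiltered_of_isCardinalFiltered J κ
    ⟨fun {K} ↦ ⟨fun {c} hc ↦ ⟨by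
      have h : IsColimit (((Functor.const C).obj (⊤_ C)).mapCocone c) :=
        have := ((Functor.const C).obj (⊤_ C)).preservesColimitsOfShape_of_isCardinalAccessible κ J
        isColimitOfPreserves _ hc
      exact Comma.fstSndJointlyReflectColimit hc h⟩⟩⟩

variable {L R : MorphismProperty C} (data : FunctorialFactorizationData L R)

/-- The endofunctor sending `c` to the middle object of the factorization of the morphism from `c`
to the terminal object. -/
noncomputable abbrev fibrantReplacement : C ⥤ C := arrowToTerminal C ⋙ data.Z

/-- The first factors of the factorizations of the morphisms to the terminal object. -/
noncomputable def fibrantReplacementUnit : 𝟭 C ⟶ fibrantReplacement data where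
  app c := data.i.app (Arrow.mk (terminal.from c))
  naturality _ _ f := data.i.naturality ((arrowToTerminal C).map f)

lemma isCardinalAccessible_fibrantReplacement [HasColimitsOfSize.{w, w} C] (κ : Cardinal.{w})
    [Fact κ.IsRegular] [(factorizationFunctor data).IsCardinalAccessible κ] :
    (fibrantReplacement data).IsCardinalAccessible κ := by
  have := isCardinalAccessible_arrowToTerminal (C := C) κ
  have : ((evaluation (Fin 3) C).obj 1).IsCardinalAccessible κ := ⟨fun J _ _ ↦ inferInstance⟩
  let F : Arrow C ⥤ (Fin 3 ⥤ C) := factorizationFunctor data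
  have : F.IsCardinalAccessible κ := ‹(factorizationFunctor data).IsCardinalAccessible κ›
  let e : F ⋙ (evaluation (Fin 3) C).obj 1 ≅ data.Z :=
    NatIso.ofComponents (fun _ ↦ Iso.refl _)
      (fun _ ↦ (Category.comp_id _).trans (Category.id_comp _).symm)
  have := Functor.isCardinalAccessible_of_natIso e κ
  infer_instance

/-- An object is injective if and only if it is a retract of its replacement: the first factor of
its morphism to the terminal object is in `L`, and the second factor is in `R`, so that the
replacement is injective. -/
lemma injectives_iff_exists_retraction [IsWeakFactorizationSystem L R] (c : C) :
    injectives L c ↔ ∃ r, (fibrantReplacementUnit data).app c ≫ r = 𝟙 c := by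
  constructor
  · intro h
    exact h ((fibrantReplacementUnit data).app c) (data.hi (Arrow.mk (terminal.from c))) (𝟙 c)
  · rintro ⟨r, hr⟩ A B i hi a
    let p : (fibrantReplacement data).obj c ⟶ ⊤_ C := data.p.app (Arrow.mk (terminal.from c))
    have : HasLiftingProperty i p := hasLiftingProperty_of_wfs i p hi (data.hp _)
    have sq : CommSq (a ≫ (fibrantReplacementUnit data).app c) i p (terminal.from B) :=
      ⟨terminal.hom_ext _ _⟩
    refine ⟨sq.lift ≫ r, ?_⟩
    rw [sq.fac_left_assoc, Category.assoc, hr, Category.comp_id]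

end FactorizationToTerminal

end AccessibleWFS

theorem mainTheorem7 {C : Type u} [Category.{v} C] [IsLocallyPresentable.{w} C]
    (L R : MorphismProperty C) (h : AccessibleWFS.IsAccessibleWFS.{w} L R) :
    ∃ (M : Type (max u v)) (_ : Category.{v} M) (F : M ⥤ C),
      IsLocallyPresentable.{w} M ∧
      PreservesLimitsOfSize.{w, w} F ∧
      Functor.IsAccessible.{w} F ∧
      AccessibleWFS.injectives L = AccessibleWFS.fullImage F := by
  obtain ⟨κ₁, _, _⟩ := IsLocallyPresentable.exists_cardinal.{w} C
  have := h.isWeakFactorizationSystem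
  obtain ⟨data, ⟨κ₂, _, _⟩⟩ := h.exists_accessible
  have : Fact (κ₁ ⊔ κ₂).IsRegular := ⟨iteInduction (fun _ ↦ Fact.out) (fun _ ↦ Fact.out)⟩
  have := IsCardinalLocallyPresentable.of_le C (le_sup_left : κ₁ ≤ κ₁ ⊔ κ₂)
  have := (AccessibleWFS.factorizationFunctor data).isCardinalAccessible_of_le
    (le_sup_right : κ₂ ≤ κ₁ ⊔ κ₂)
  have := AccessibleWFS.hasTerminal_of_isCardinalLocallyPresentable C κ₁
  have := AccessibleWFS.isCardinalAccessible_fibrantReplacement data (κ₁ ⊔ κ₂)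
  have heq : AccessibleWFS.injectives L =
      fun c ↦ ∃ r, (AccessibleWFS.fibrantReplacementUnit data).app c ≫ r = 𝟙 c := by
    ext c
    exact AccessibleWFS.injectives_iff_exists_retraction data c
  rw [heq]
  exact AccessibleWFS.exists_fullImage_of_pointed (κ₁ ⊔ κ₂)
    (AccessibleWFS.fibrantReplacementUnit data)
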